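/- Let $\Gamma$ be a Coxeter group with finite generating set $S$ and let $X$ be its Davis complex, the union of the chambers $gC$, $g\in\Gamma$. The faces of $gC$ are the sets $gC\cap gsC$, $s\in S$. A wall is the fixed point set in $X$ of a reflection, that is, of a conjugate of an element of $S$. Its complement has two components, and each face $gC\cap gsC$ lies on exactly one wall, the one of $gsg^{-1}$. Let $\mathcal W$ be the set of walls, let $F$ be a finite set of colors, and let $\phi:\mathcal W\to F$ be a coloring such that distinct walls of the same color are disjoint. *Level.* For a color $c$, remove all walls of color $c$ from $X$. Those that bound the component of the base chamber $C$ have level $1$. Drop them and repeat the procedure with the other walls of color $c$ to obtain the walls of level $2$, and so on. *Orientation.* To orient a wall is to call one component of its complement left and the other one right. The orientation has sign $+1$ if $C$ is on the left, and $-1$ otherwise. Choose signs $\varepsilon_c\in\{1,-1\}$ for $c\in F$, and give each wall of color $c$ and level $n$ the orientation of sign $\varepsilon_c(-1)^n$. *Geometric resolution.* The geometric resolution $\phi'$ is the tiling of $X$ by the chambers in which every face of a chamber carries the label $c_+$ or $c_-$, where $c$ is the color of the wall containing the face; the sign is $+$ if the interior of the chamber lies to the left of this wall, and $-$ otherwise.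 The opposition function exchanges $c_+$ and $c_-$. The matching rule says that the common face of two adjacent chambers carries opposite labels in the two chambers. A tile is a chamber with labelled faces. The group $\Gamma$ acts on such labelled families of chambers by translation, and a limit tiling of $\phi'$ is an element of the closure of the orbit $\Gamma\phi'$ in the topology of pointwise convergence of the labels. *Strict balance.* A weight function is a function $w:\{c_+,c_-: c\in F\}\to\mathbb Z$ with $w(c_-)=-w(c_+)$ for all $c$. A tiling is strictly balanced if, for every weight function $w$ that does not vanish on all labels occurring in the tiling, there are tiles $t_+$ and $t_-$ occurring in it with $\sum_{f\in t_+}w(f)>0$ and $\sum_{f\in t_-}w(f)<0$, where the sums run over the faces of the tile and $w(f)$ is the weight of the label of $f$. **Theorem.** For every choice of the signs $\varepsilon_c$, the geometric resolution $\phi'$ satisfies the matching rule and is strictly balanced. Moreover, every limit tiling of $\phi'$ satisfies the matching rule and is strictly balanced. -/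

import Mathlib

noncomputable section

namespace DavisTiling

section DavisComplex

variable {B W : Type*} [Group W] {M : CoxeterMatrix B} (cs : CoxeterSystem M W)

/-- The subgroup of the Coxeter group generated by a set of simple reflections. -/
def parabolic (T : Set B) : Subgroup W := Subgroup.closure (cs.simple '' T)

/-- The sets of generators that generate a finite subgroup, ordered by inclusion. The nonempty ones
are the simplices of the nerve; as vertices of the chamber they are the barycenters of these
simplices, and the empty set is the cone point. -/
abbrev Spherical : Type _ := {T : Set B // (parabolic cs T : Set W).Finite}

/-- The vertices of the Davis complex: pairs `(g, v_T)`, where `(a, v_T)` and `(b, v_T)` are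
identified when `a⁻¹ * b` lies in the subgroup generated by `T`. -/
abbrev Vertex : Type _ := Σ T : Spherical cs, W ⧸ parabolic cs T.1

variable {cs} in
/-- The vertex `g v_T` of the chamber `g C`. -/
def vertex (g : W) (T : Spherical cs) : Vertex cs := ⟨T, QuotientGroup.mk g⟩

/-- The simplices of the Davis complex are the translates of the simplices of the chamber, the
cone over the barycentric subdivision of the nerve. -/
def IsSimplex (s : Set (Vertex cs)) : Prop :=
  ∃ (g : W) (c : Set (Spherical cs)), IsChain (· ≤ ·) c ∧ s = vertex g '' c

/-- The Davis complex, as a topological space: its points are given by their barycentric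
coordinates. It carries the topology of coordinatewise convergence, which is the usual topology
since the complex is locally finite when there are finitely many generators. -/
@[ext] structure Davis where
  coord : Vertex cs → ℝ
  coord_nonneg : ∀ v, 0 ≤ coord v
  isSimplex_support : IsSimplex cs (Function.support coord)
  sum_coord : ∑ᶠ v, coord v = 1

instance : TopologicalSpace (Davis cs) := TopologicalSpace.induced Davis.coord inferInstance

variable {cs} in
/-- The group acts on the vertices by left multiplication. -/
theorem smul_vertex (h g : W) (T : Spherical cs) : h • vertex g T = vertex (h * g) T := rfl

theorem isSimplex_support_smul {x : Vertex cs → ℝ} (h : W)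
    (hx : IsSimplex cs (Function.support x)) :
    IsSimplex cs (Function.support fun v => x (h⁻¹ • v)) := by
  obtain ⟨g, c, hc, hs⟩ := hx
  refine ⟨h * g, c, hc, ?_⟩
  ext v
  have hv : v ∈ Function.support (fun v => x (h⁻¹ • v)) ↔ h⁻¹ • v ∈ vertex g '' c := by
    rw [← hs]; rfl
  rw [hv]
  constructor
  · rintro ⟨T, hT, e⟩
    exact ⟨T, hT, by rw [← smul_vertex, e, smul_inv_smul]⟩
  · rintro ⟨T, hT, rfl⟩
    exact ⟨T, hT, by rw [← smul_vertex, inv_smul_smul]⟩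

/-- The induced simplicial action on the Davis complex. -/
instance : MulAction W (Davis cs) where
  smul h x :=
    { coord := fun v => x.coord (h⁻¹ • v)
      coord_nonneg := fun v => x.coord_nonneg _
      isSimplex_support := isSimplex_support_smul cs h x.isSimplex_support
      sum_coord := (finsum_comp_equiv (MulAction.toPerm h⁻¹ : Equiv.Perm (Vertex cs))).trans
        x.sum_coord }
  one_smul x := by
    ext v
    change x.coord ((1 : W)⁻¹ • v) = x.coord v
    rw [inv_one, one_smul]
  mul_smul g h x := by
    ext v
    change x.coord ((g * h)⁻¹ • v) = x.coord (h⁻¹ • g⁻¹ • v)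
    rw [mul_inv_rev, mul_smul]

/-- The empty simplex of the nerve. -/
def coneVertex : Spherical cs := ⟨∅, by simp [parabolic]⟩

open Classical in
/-- The cone point of the base chamber. -/
def basePoint : Davis cs where
  coord := Pi.single (vertex 1 (coneVertex cs)) 1
  coord_nonneg v := by
    by_cases h : v = vertex 1 (coneVertex cs)
    · subst h; simp
    · simp [h]
  isSimplex_support := ⟨1, {coneVertex cs}, by simp [IsChain], by simp⟩
  sum_coord := by
    rw [finsum_eq_single _ (vertex 1 (coneVertex cs)) (fun v hv => by simp [hv])]
    simp

/-- The chamber `g C`. -/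
def chamber (g : W) : Set (Davis cs) :=
  {x | Function.support x.coord ⊆ Set.range (vertex g)}

/-- The walls: the fixed point sets of the reflections, that is, of the conjugates of the
generators. -/
abbrev Wall : Type _ :=
  {m : Set (Davis cs) // ∃ r : W, cs.IsReflection r ∧ m = MulAction.fixedBy (Davis cs) r}

/-- The wall between the adjacent chambers `g C` and `g s C`. -/
def wallAt (g : W) (b : B) : Wall cs :=
  ⟨MulAction.fixedBy (Davis cs) (g * cs.simple b * g⁻¹), _, ⟨g, b, rfl⟩, rfl⟩

/-- The face of the chamber `g C` of type `b`. -/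
def face (g : W) (b : B) : Set (Davis cs) := chamber cs g ∩ (wallAt cs g b).1

/-- The open chamber: the chamber without its faces. -/
def openChamber (g : W) : Set (Davis cs) := chamber cs g \ ⋃ b, face cs g b

/-- The component of the complement of a wall that contains the base chamber. -/
def baseSide (m : Wall cs) : Set (Davis cs) := connectedComponentIn (m.1)ᶜ (basePoint cs)

/-- An orientation of the walls, that is, a choice of the left one of the two components of the
complement of each wall, is recorded by signs: `+` if the left component is the one
that contains the base chamber (the canonical orientation), `-` if it is the other one. -/
abbrev Orientation : Type _ := Wall cs → ℤˣ

open Classical in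
variable {cs} in
/-- The left component of the complement of a wall. -/
def Orientation.left (σ : Orientation cs) (m : Wall cs) : Set (Davis cs) :=
  if σ m = 1 then baseSide cs m else (m.1)ᶜ \ baseSide cs m

end DavisComplex

section Levels

variable {B W F : Type*} [Group W] {M : CoxeterMatrix B} (cs : CoxeterSystem M W)

/-- The component of the base chamber after removing a set of walls from the Davis complex. -/
def baseComponent (R : Set (Wall cs)) : Set (Davis cs) :=
  connectedComponentIn (⋃ m ∈ R, m.1)ᶜ (basePoint cs)

variable {cs}

/-- The walls of color `c` that are left after `n` steps, where in each step the walls that bound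
the component of the base chamber are dropped. -/
def remaining (φ : Wall cs → F) (c : F) : ℕ → Set (Wall cs)
  | 0 => {m | φ m = c}
  | n + 1 => {m ∈ remaining φ c n |
      ¬ (m.1 ∩ closure (baseComponent cs (remaining φ c n))).Nonempty}

/-- The level of a wall: the number of the step in which it is dropped from the walls of its
color. The walls of level one are those that bound the component of the base chamber. -/
def level (φ : Wall cs → F) (m : Wall cs) : ℕ := sInf {n | m ∉ remaining φ (φ m) n}

/-- The orientation that alternates by level on the walls of each color `c`; the sign
on level `n` is `ε c * (-1) ^ n`. -/
def alternating (φ : Wall cs → F) (ε : F → ℤˣ) : Orientation cs :=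
  fun m => ε (φ m) * (-1) ^ level φ m

end Levels

section Tilings

/-- A set of tiles `T`, each with faces indexed by `B` and labelled in `L`, with opposition
function `o`, is strictly balanced if every weight function that is nontrivial (on
the faces of the tiles in `T`) has positive sum on some tile and negative sum on some tile. -/
def StrictlyBalancedTiles {B L : Type*} [Fintype B] (o : L → L) (T : Set (B → L)) : Prop :=
  ∀ w : L → ℤ, (∀ f, w (o f) = - w f) → (∃ t ∈ T, ∃ b, w (t b) ≠ 0) →
    (∃ t ∈ T, 0 < ∑ b, w (t b)) ∧ (∃ t ∈ T, ∑ b, w (t b) < 0)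

/-- The faces of the tiles of a geometric resolution: two copies `c₊` and `c₋` of
each color `c`. -/
abbrev SignedColor (F : Type*) : Type _ := F × ℤˣ

/-- The opposition function, exchanging `c₊` and `c₋`. -/
def opp {F : Type*} (f : SignedColor F) : SignedColor F := (f.1, -f.2)

/-- A covering of the Davis complex by the chambers `g C`, each of which carries the structure of
a tile: its face of type `b` has the label `label g b`. -/
@[ext] structure Tiled (B W F : Type*) where
  label : W → B → SignedColor F

namespace Tiled

variable {B W F : Type*}

/-- The set of tiles that occur. -/
def tiles (τ : Tiled B W F) : Set (B → SignedColor F) := Set.range τ.label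

/-- The minimal set of tiles is strictly balanced. -/
def StrictlyBalanced [Fintype B] (τ : Tiled B W F) : Prop := StrictlyBalancedTiles opp τ.tiles

/-- The matching rule of a tiling: the labels of the common face of the adjacent chambers
`g C` and `g s C` are opposite. -/
def IsTiling [Group W] {M : CoxeterMatrix B} (cs : CoxeterSystem M W) (τ : Tiled B W F) : Prop :=
  ∀ (g : W) (b : B), τ.label (g * cs.simple b) b = opp (τ.label g b)

/-- The topology of pointwise convergence of the labels, which are taken discrete. -/
instance : TopologicalSpace (Tiled B W F) :=
  TopologicalSpace.induced Tiled.label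
    (@Pi.topologicalSpace W (fun _ => B → SignedColor F) fun _ =>
      @Pi.topologicalSpace B (fun _ => SignedColor F) fun _ => ⊥)

/-- The group moves tilings: the tile of `h • τ` on the chamber `g C` is the image under `h` of
the tile of `τ` on the chamber `h⁻¹ g C`. -/
instance [Group W] : MulAction W (Tiled B W F) where
  smul h τ := ⟨fun g b => τ.label (h⁻¹ * g) b⟩
  one_smul τ := by
    ext1
    funext g b
    change τ.label ((1 : W)⁻¹ * g) b = τ.label g b
    rw [inv_one, one_mul]
  mul_smul h k τ := by
    ext1
    funext g b
    change τ.label ((h * k)⁻¹ * g) b = τ.label (k⁻¹ * (h⁻¹ * g)) b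
    rw [mul_inv_rev, mul_assoc]

/-- The limit tilings: the elements of the closure of the orbit. -/
def IsLimitOf [Group W] (β τ : Tiled B W F) : Prop := β ∈ closure (MulAction.orbit W τ)

end Tiled

variable {B W F : Type*} [Group W] {M : CoxeterMatrix B} {cs : CoxeterSystem M W}

open Classical in
/-- The geometric resolution of the tiling by a coloring `φ` of the walls that belongs to an
orientation: a face of a chamber has the color of its wall, and the sign `+` if the
interior of the chamber is left of this wall, `-` otherwise. -/
def resolution (φ : Wall cs → F) (σ : Orientation cs) : Tiled B W F where
  label g b :=
    (φ (wallAt cs g b), if openChamber cs g ⊆ σ.left (wallAt cs g b) then 1 else -1)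

end Tilings

end DavisTiling

end

/-! For a color c, let the depth of a chamber gC be the number of walls of color c that separate it
from C. Crossing a face of color c changes this depth by one, and crossing any other face leaves it
unchanged. The key claim is that a wall has level one more than the depth of any adjacent chamber on
its base side (`level_wallAt`). It follows that every face of color c of gC has sign -ε_c(-1)^depth
(`resolution_label`). So the faces of one color of a chamber share one sign, and crossing a face
reverses the sign of its color and no other. The matching rule is then immediate.

For strict balance, start at a chamber with a face of nonzero weight and keep crossing faces of
negative weight. Each crossing makes one more color nonnegative, so after at most |F| steps no face
is negative, while some face is positive (`exists_pos_tile`). Replacing w by -w gives the negative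
tile. The search stays in a finite patch, and a limit tiling agrees with a translate of the
resolution on such a patch, so the argument passes to limits.

The level formula rests on the fact that a wall disjoint from m' lies on one side of m'
(`sep_eq_of_disjoint`). Sides are encoded by crossing parity, a potential on the Cayley graph
(`exists_potential`), and compared with topological components by means of cone points and midpoints
of faces. -/

noncomputable section

namespace DavisTiling

open Function Set

/-! ### Potentials on the Cayley graph and dihedral relators -/

section Potential

variable {B W : Type*} [Group W] {M : CoxeterMatrix B} (cs : CoxeterSystem M W)

/-- A `ZMod 2`-valued function on the edges of the Cayley graph that sums to zero along the
boundary of each relator is the coboundary of a function on the vertices. -/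
theorem exists_potential (f : W → B → ZMod 2)
    (hf : ∀ g i j, ∑ k ∈ Finset.range (M i j), (f (g * (cs.simple j * cs.simple i) ^ k) j +
      f (g * (cs.simple j * cs.simple i) ^ k * cs.simple j) i) = 0) :
    ∃ χ : W → ZMod 2, χ 1 = 0 ∧ ∀ g b, χ (g * cs.simple b) = χ g + f g b := by
  -- The double cover of the Cayley graph defined by the cocycle f: a generator moves along an edge
  -- and adds its value. Vanishing on relators makes this an action of the group.
  let step : B → Function.End (W × ZMod 2) :=
    fun b => fun p => (p.1 * cs.simple b, p.2 + f p.1 b)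
  have hpow : ∀ i j n g e, ((step i * step j) ^ n) (g, e) =
      (g * (cs.simple j * cs.simple i) ^ n, e + ∑ k ∈ Finset.range n,
        (f (g * (cs.simple j * cs.simple i) ^ k) j +
          f (g * (cs.simple j * cs.simple i) ^ k * cs.simple j) i)) := by
    intro i j n g e
    induction n with
    | zero => simp [Function.End.one_def]
    | succ n ih =>
      rw [pow_succ']
      change step i (step j (((step i * step j) ^ n) (g, e))) = _
      rw [ih, Finset.sum_range_succ]
      simp only [step, Prod.mk.injEq]
      exact ⟨by rw [pow_succ]; group, by ring⟩
  have hlift : M.IsLiftable step := by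
    intro i j
    funext ⟨g, e⟩
    rw [hpow, hf, cs.simple_mul_simple_pow']
    simp [Function.End.one_def]
  let Φ := cs.lift ⟨step, hlift⟩
  have hΦ : ∀ b, Φ (cs.simple b) = step b := fun b => cs.lift_apply_simple hlift b
  have hfst : ∀ g, (Φ g⁻¹ (1, 0)).1 = g := by
    intro g
    induction g using cs.simple_induction_right with
    | one => rw [inv_one, map_one]; rfl
    | mul_simple_right g b ih =>
      rw [mul_inv_rev, cs.inv_simple, map_mul, hΦ]
      change (Φ g⁻¹ (1, 0)).1 * cs.simple b = _
      rw [ih]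
  -- The inverse appears because a left action is used to perform right multiplications.
  refine ⟨fun g => (Φ g⁻¹ (1, 0)).2, ?_, ?_⟩
  · change (Φ (1 : W)⁻¹ (1, 0)).2 = 0
    rw [inv_one, map_one]; rfl
  · intro g b
    change (Φ (g * cs.simple b)⁻¹ (1, 0)).2 = _
    rw [mul_inv_rev, cs.inv_simple, map_mul, hΦ]
    change (Φ g⁻¹ (1, 0)).2 + f (Φ g⁻¹ (1, 0)).1 b = _
    rw [hfst]

/-- The reflections in the dihedral subgroup generated by two simple reflections, in the order in
which their walls are crossed. -/
theorem dihedral_reflection (i j : B) (k : ℕ) :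
    (cs.simple j * cs.simple i) ^ k * cs.simple j * ((cs.simple j * cs.simple i) ^ k)⁻¹ =
      (cs.simple j * cs.simple i) ^ (2 * k) * cs.simple j := by
  have h : SemiconjBy (cs.simple j) (cs.simple j * cs.simple i)⁻¹
      (cs.simple j * cs.simple i) := by
    simp [SemiconjBy, mul_assoc]
  have := (h.pow_right k).eq
  rw [inv_pow] at this
  rw [mul_assoc, this, ← mul_assoc, ← pow_add, two_mul]

theorem dihedral_reflection' (i j : B) (k : ℕ) :
    (cs.simple j * cs.simple i) ^ k * cs.simple j * cs.simple i *
      ((cs.simple j * cs.simple i) ^ k * cs.simple j)⁻¹ =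
      (cs.simple j * cs.simple i) ^ (2 * k + 1) * cs.simple j := by
  have h := dihedral_reflection cs i j k
  rw [mul_inv_rev, cs.inv_simple, ← mul_assoc, mul_assoc _ (cs.simple j) (cs.simple i),
    ← pow_succ]
  calc _ = (cs.simple j * cs.simple i) * ((cs.simple j * cs.simple i) ^ k * cs.simple j *
        ((cs.simple j * cs.simple i) ^ k)⁻¹) := by rw [pow_succ']; group
    _ = _ := by rw [h, pow_succ']; simp only [mul_assoc]

/-- Along the boundary of a relator each reflection is crossed an even number of times. -/
theorem sum_relator (F : W → ZMod 2) (i j : B) :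
    ∑ k ∈ Finset.range (M i j),
      (F ((cs.simple j * cs.simple i) ^ k * cs.simple j *
        ((cs.simple j * cs.simple i) ^ k)⁻¹) +
      F ((cs.simple j * cs.simple i) ^ k * cs.simple j * cs.simple i *
        ((cs.simple j * cs.simple i) ^ k * cs.simple j)⁻¹)) = 0 := by
  simp only [dihedral_reflection, dihedral_reflection']
  have hsum : ∀ (G : ℕ → ZMod 2) n, ∑ k ∈ Finset.range n, (G (2 * k) + G (2 * k + 1)) =
      ∑ k ∈ Finset.range (n + n), G k := by
    intro G n
    induction n with
    | zero => simp
    | succ n ih =>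
      rw [Finset.sum_range_succ, ih, show n + 1 + (n + 1) = n + n + 1 + 1 by ring,
        Finset.sum_range_succ, Finset.sum_range_succ, ← two_mul, add_assoc]
  -- The terms k and k + M i j belong to the same reflection, so they cancel modulo two.
  rw [hsum (fun k => F ((cs.simple j * cs.simple i) ^ k * cs.simple j)), Finset.sum_range_add]
  simp only [pow_add, cs.simple_mul_simple_pow', one_mul]
  exact CharTwo.add_self_eq_zero _

/-- A dihedral subgroup generated by two simple reflections is finite if their product has finite
order. -/
theorem parabolic_pair_finite (i j : B) (h : M i j ≠ 0) :
    (parabolic cs {i, j} : Set W).Finite := by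
  set a := cs.simple j * cs.simple i with ha
  have hfin : IsOfFinOrder a :=
    isOfFinOrder_iff_pow_eq_one.2 ⟨M i j, Nat.pos_of_ne_zero h, cs.simple_mul_simple_pow' i j⟩
  have hz : (Subgroup.zpowers a : Set W).Finite := hfin.finite_zpowers
  refine (hz.union (hz.image (· * cs.simple j))).subset ?_
  have hsemi : SemiconjBy (cs.simple j) a a⁻¹ := by simp [SemiconjBy, ha]
  -- Rotations and reflections of the dihedral group; closure under left multiplication by both
  -- generators suffices.
  set S : Set W := (Subgroup.zpowers a : Set W) ∪ (· * cs.simple j) '' (Subgroup.zpowers a : Set W)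
  have hj : ∀ z ∈ S, cs.simple j * z ∈ S := by
    rintro z (⟨n, rfl⟩ | ⟨_, ⟨n, rfl⟩, rfl⟩)
    · refine Or.inr ⟨a⁻¹ ^ n, ⟨-n, by simp⟩, ?_⟩
      exact (hsemi.zpow_right n).eq.symm
    · refine Or.inl ⟨-n, ?_⟩
      change a ^ (-n) = cs.simple j * (a ^ n * cs.simple j)
      rw [← mul_assoc, (hsemi.zpow_right n).eq, cs.simple_mul_simple_cancel_right]
      simp
  have hi : ∀ z ∈ S, cs.simple i * z ∈ S := by
    intro z hz
    have haz : a * z ∈ S := by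
      obtain ⟨n, rfl⟩ | ⟨_, ⟨n, rfl⟩, rfl⟩ := hz
      · exact Or.inl ⟨1 + n, by simp [zpow_add]⟩
      · exact Or.inr ⟨a ^ (1 + n), ⟨1 + n, rfl⟩, by simp [zpow_add, mul_assoc]⟩
    have := hj _ haz
    rwa [ha, mul_assoc, cs.simple_mul_simple_cancel_left] at this
  have hmem : ∀ y ∈ cs.simple '' {i, j}, ∀ z ∈ S, y * z ∈ S := by
    rintro _ ⟨b, rfl | rfl, rfl⟩
    · exact hi
    · exact hj
  intro x hx
  have hx' : x ∈ parabolic cs {i, j} := hx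
  clear hx
  unfold parabolic at hx'
  induction hx' using Subgroup.closure_induction_left with
  | one => exact Or.inl (one_mem _)
  | mul_left y hy z hz ih => exact hmem y hy z ih
  | inv_mul_cancel y hy z hz ih =>
    obtain ⟨b, hb, rfl⟩ := hy
    rw [cs.inv_simple]
    exact hmem _ ⟨b, hb, rfl⟩ z ih

end Potential

/-! ### Chambers, stabilizers and walls through carriers of points -/

section Geometry

variable {B W : Type*} [Group W] {M : CoxeterMatrix B} {cs : CoxeterSystem M W}

theorem vertex_eq_iff {g h : W} {T T' : Spherical cs} :
    vertex g T = vertex h T' ↔ T = T' ∧ g⁻¹ * h ∈ parabolic cs T.1 := by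
  constructor
  · intro e
    obtain rfl : T = T' := congrArg Sigma.fst e
    exact ⟨rfl, QuotientGroup.eq.1 (eq_of_heq (Sigma.mk.inj e).2)⟩
  · rintro ⟨rfl, h⟩
    exact congrArg (Sigma.mk T) (QuotientGroup.eq.2 h)

theorem parabolic_mono {T T' : Set B} (h : T ⊆ T') : parabolic cs T ≤ parabolic cs T' :=
  Subgroup.closure_mono (image_mono h)

theorem simple_mem_parabolic {T : Set B} {b : B} (h : b ∈ T) : cs.simple b ∈ parabolic cs T :=
  Subgroup.subset_closure (mem_image_of_mem _ h)

theorem parabolic_singleton (b : B) :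
    (parabolic cs {b} : Set W) = {1, cs.simple b} := by
  ext x
  rw [parabolic, image_singleton, SetLike.mem_coe, Subgroup.mem_closure_singleton]
  constructor
  · rintro ⟨n, rfl⟩
    rcases Int.even_or_odd' n with ⟨k, rfl | rfl⟩
    · left; rw [zpow_mul]; simp
    · right; rw [zpow_add, zpow_mul]; simp
  · rintro (rfl | rfl)
    · exact ⟨0, zpow_zero _⟩
    · exact ⟨1, zpow_one _⟩

theorem parabolic_empty : parabolic cs ∅ = ⊥ := by simp [parabolic]

/-- The barycenter of the simplex of the nerve that belongs to a generator. -/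
def faceVertex (cs : CoxeterSystem M W) (b : B) : Spherical cs :=
  ⟨{b}, by rw [parabolic_singleton]; exact Set.toFinite _⟩

/-- The smallest vertex of the carrier of a point in the chamber `g C`. -/
def IsCarrier (x : Davis cs) (g : W) (T : Spherical cs) : Prop :=
  vertex g T ∈ support x.coord ∧ ∀ v ∈ support x.coord, ∃ T', T ≤ T' ∧ v = vertex g T'

theorem support_nonempty (x : Davis cs) : (support x.coord).Nonempty := by
  by_contra h
  have h0 : x.coord = 0 := support_eq_empty_iff.1 (not_nonempty_iff_eq_empty.1 h)
  have := x.sum_coord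
  simp [h0] at this

theorem exists_support_eq {x : Davis cs} {g : W} (hx : x ∈ chamber cs g) :
    ∃ c : Set (Spherical cs), IsChain (· ≤ ·) c ∧ support x.coord = vertex g '' c := by
  obtain ⟨h, c, hc, hs⟩ := x.isSimplex_support
  refine ⟨c, hc, ?_⟩
  rw [hs]
  refine image_congr fun T hT => ?_
  obtain ⟨T', hT'⟩ := hx (hs ▸ mem_image_of_mem _ hT)
  obtain ⟨rfl, -⟩ := vertex_eq_iff.1 hT'
  exact hT'.symm

theorem exists_carrier [Finite B] {x : Davis cs} {g : W} (hx : x ∈ chamber cs g) :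
    ∃ T, IsCarrier x g T := by
  obtain ⟨c, hc, hs⟩ := exists_support_eq hx
  have hne : c.Nonempty := by
    rw [← image_nonempty (f := vertex g), ← hs]; exact support_nonempty x
  obtain ⟨T, hT⟩ := c.toFinite.exists_minimal hne
  refine ⟨T, hs ▸ mem_image_of_mem _ hT.prop, ?_⟩
  intro v hv
  obtain ⟨T', hT', rfl⟩ := hs ▸ hv
  refine ⟨T', ?_, rfl⟩
  rcases hc.total hT.prop hT' with h | h
  · exact h
  · exact hT.le_of_le hT' h

theorem IsCarrier.mem_chamber_iff {x : Davis cs} {g : W} {T : Spherical cs}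
    (hT : IsCarrier x g T) (h : W) : x ∈ chamber cs h ↔ g⁻¹ * h ∈ parabolic cs T.1 := by
  constructor
  · intro hx
    obtain ⟨T', hT'⟩ := hx hT.1
    obtain ⟨-, e⟩ := vertex_eq_iff.1 hT'.symm
    exact e
  · intro hh v hv
    obtain ⟨T', hle, rfl⟩ := hT.2 v hv
    exact ⟨T', (vertex_eq_iff.2 ⟨rfl, parabolic_mono hle hh⟩).symm⟩

theorem IsCarrier.translate {x : Davis cs} {g h : W} {T : Spherical cs} (hT : IsCarrier x g T)
    (hx : x ∈ chamber cs h) : IsCarrier x h T := by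
  have hm := (hT.mem_chamber_iff h).1 hx
  refine ⟨?_, fun v hv => ?_⟩
  · rw [← vertex_eq_iff.2 ⟨rfl, hm⟩]; exact hT.1
  · obtain ⟨T', hle, rfl⟩ := hT.2 v hv
    exact ⟨T', hle, vertex_eq_iff.2 ⟨rfl, parabolic_mono hle hm⟩⟩

theorem smul_coord (h : W) (x : Davis cs) (v : Vertex cs) :
    (h • x).coord v = x.coord (h⁻¹ • v) := rfl

theorem smul_mem_chamber {x : Davis cs} {g : W} (hx : x ∈ chamber cs g) (h : W) :
    h • x ∈ chamber cs (h * g) := by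
  intro v hv
  obtain ⟨T, hT⟩ := hx (show h⁻¹ • v ∈ support x.coord from hv)
  exact ⟨T, by rw [← smul_vertex, hT, smul_inv_smul]⟩

/-- The action preserves the type of a vertex, so an element that keeps x in its chamber fixes every
vertex of its support. This turns questions about walls into questions about parabolic subgroups. -/
theorem IsCarrier.smul_eq_iff {x : Davis cs} {g : W} {T : Spherical cs}
    (hT : IsCarrier x g T) (r : W) : r • x = x ↔ g⁻¹ * r * g ∈ parabolic cs T.1 := by
  constructor
  · intro h
    have hx := smul_mem_chamber ((hT.mem_chamber_iff g).2 (by simp)) r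
    rw [h, hT.mem_chamber_iff] at hx
    rwa [mul_assoc]
  · intro h
    have key : ∀ k : W, g⁻¹ * k * g ∈ parabolic cs T.1 → ∀ v ∈ support x.coord, k • v = v := by
      intro k hk v hv
      obtain ⟨T', hle, rfl⟩ := hT.2 v hv
      rw [smul_vertex, eq_comm, vertex_eq_iff]
      exact ⟨rfl, by rw [← mul_assoc]; exact parabolic_mono hle hk⟩
    have hinv : g⁻¹ * r⁻¹ * g ∈ parabolic cs T.1 := by
      have := inv_mem h
      rwa [mul_inv_rev, mul_inv_rev, inv_inv, ← mul_assoc] at this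
    ext v
    rw [smul_coord]
    by_cases hv : v ∈ support x.coord
    · rw [key _ hinv v hv]
    · by_cases hv' : r⁻¹ • v ∈ support x.coord
      · have := key _ h _ hv'
        rw [smul_inv_smul] at this
        rw [← this]
      · rw [notMem_support.1 hv, notMem_support.1 hv']

open Classical in
/-- A vertex of the Davis complex as a point. -/
def vertexPoint (g : W) (T : Spherical cs) : Davis cs where
  coord := Pi.single (vertex g T) 1
  coord_nonneg v := by
    by_cases h : v = vertex g T
    · subst h; simp
    · simp [h]
  isSimplex_support := ⟨g, {T}, by simp [IsChain], by simp⟩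
  sum_coord := by
    rw [finsum_eq_single _ (vertex g T) (fun v hv => by simp [hv])]
    simp

theorem support_vertexPoint (g : W) (T : Spherical cs) :
    support (vertexPoint g T).coord = {vertex g T} := by
  simp [vertexPoint]

theorem isCarrier_vertexPoint (g : W) (T : Spherical cs) : IsCarrier (vertexPoint g T) g T := by
  constructor
  · rw [support_vertexPoint]; rfl
  · rw [support_vertexPoint]
    rintro v rfl
    exact ⟨T, le_rfl, rfl⟩

theorem vertexPoint_mem_chamber (g : W) (T : Spherical cs) : vertexPoint g T ∈ chamber cs g :=
  ((isCarrier_vertexPoint g T).mem_chamber_iff g).2 (by simp)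

theorem vertexPoint_faceVertex (g : W) (b : B) :
    vertexPoint (g * cs.simple b) (faceVertex cs b) = vertexPoint g (faceVertex cs b) := by
  have : vertex (g * cs.simple b) (faceVertex cs b) = vertex g (faceVertex cs b) :=
    (vertex_eq_iff.2 ⟨rfl, by
      rw [inv_mul_cancel_left]; exact simple_mem_parabolic (mem_singleton b)⟩).symm
  ext v
  simp [vertexPoint, this]

theorem mem_wallAt_iff {x : Davis cs} {g : W} {b : B} :
    x ∈ (wallAt cs g b).1 ↔ (g * cs.simple b * g⁻¹) • x = x := Iff.rfl

/-- The stabilizer of the midpoint of a face has order two, and a reflection is not the identity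
because its length is odd. Hence the midpoint lies on a single wall, and a wall determines its
reflection. -/
theorem faceVertex_mem_wall_iff {g r : W} {b : B} (hr : cs.IsReflection r) :
    r • vertexPoint g (faceVertex cs b) = vertexPoint g (faceVertex cs b) ↔
      r = g * cs.simple b * g⁻¹ := by
  rw [(isCarrier_vertexPoint g _).smul_eq_iff, faceVertex, ← SetLike.mem_coe,
    parabolic_singleton]
  constructor
  · rintro (h | h)
    · exfalso
      have h1 : r = 1 := by
        have : g * (g⁻¹ * r * g) * g⁻¹ = g * 1 * g⁻¹ := by rw [h]
        simpa [mul_assoc] using this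
      have := hr.odd_length
      simp [h1] at this
    · rw [← (show g⁻¹ * r * g = cs.simple b from h)]; group
  · rintro rfl
    right
    simp [mul_assoc]

theorem wallAt_eq_of_reflection {g h : W} {a b : B}
    (e : g * cs.simple a * g⁻¹ = h * cs.simple b * h⁻¹) : wallAt cs g a = wallAt cs h b :=
  Subtype.ext (by simp [wallAt, e])

theorem faceVertex_mem_wallAt (g : W) (b : B) :
    vertexPoint g (faceVertex cs b) ∈ (wallAt cs g b).1 :=
  mem_wallAt_iff.2 ((faceVertex_mem_wall_iff ⟨g, b, rfl⟩).2 rfl)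

theorem eq_wallAt_of_faceVertex_mem {m : Wall cs} {g : W} {b : B}
    (h : vertexPoint g (faceVertex cs b) ∈ m.1) : m = wallAt cs g b := by
  obtain ⟨m, r, hr, rfl⟩ := m
  obtain rfl := (faceVertex_mem_wall_iff hr).1 h
  rfl

theorem wallAt_eq_iff {g h : W} {a b : B} : wallAt cs g a = wallAt cs h b ↔
    g * cs.simple a * g⁻¹ = h * cs.simple b * h⁻¹ := by
  refine ⟨fun e => ?_, wallAt_eq_of_reflection⟩
  have h1 := faceVertex_mem_wallAt (cs := cs) g a
  rw [e] at h1
  exact ((faceVertex_mem_wall_iff ⟨h, b, rfl⟩).1 (mem_wallAt_iff.1 h1)).symm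

theorem wallAt_mul_simple (g : W) (b : B) : wallAt cs (g * cs.simple b) b = wallAt cs g b :=
  wallAt_eq_of_reflection (by simp [mul_assoc])

theorem exists_eq_wallAt (m : Wall cs) : ∃ g b, m = wallAt cs g b := by
  obtain ⟨m, r, ⟨g, b, rfl⟩, rfl⟩ := m
  exact ⟨g, b, rfl⟩

end Geometry

/-! ### Sides of a wall as crossing parities -/

section Separation

variable {B W : Type*} [Group W] {M : CoxeterMatrix B} {cs : CoxeterSystem M W}

open Classical in
theorem sum_wall_relator (m : Wall cs) (g : W) (i j : B) :
    ∑ k ∈ Finset.range (M i j),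
      ((if wallAt cs (g * (cs.simple j * cs.simple i) ^ k) j = m then 1 else 0) +
      (if wallAt cs (g * (cs.simple j * cs.simple i) ^ k * cs.simple j) i = m then 1 else 0) :
        ZMod 2) = 0 := by
  refine Eq.trans (Finset.sum_congr rfl fun k _ => ?_) (sum_relator cs
    (fun t => if MulAction.fixedBy (Davis cs) (g * t * g⁻¹) = m.1 then 1 else 0) i j)
  simp only [Subtype.ext_iff, wallAt, mul_inv_rev, mul_assoc]

open Classical in
theorem exists_separation (m : Wall cs) : ∃ χ : W → ZMod 2, χ 1 = 0 ∧
    ∀ g b, χ (g * cs.simple b) = χ g + if wallAt cs g b = m then 1 else 0 :=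
  exists_potential cs _ (sum_wall_relator m)

/-- The number of times, modulo two, that a gallery from the base chamber to `g C` crosses a
wall. -/
def sep (m : Wall cs) : W → ZMod 2 := (exists_separation m).choose

theorem sep_one (m : Wall cs) : sep m 1 = 0 := (exists_separation m).choose_spec.1

theorem sep_mul_simple_self (g : W) (b : B) :
    sep (wallAt cs g b) (g * cs.simple b) = sep (wallAt cs g b) g + 1 := by
  classical
  have := (exists_separation (wallAt cs g b)).choose_spec.2 g b
  rwa [if_pos rfl] at this

theorem sep_mul_simple_of_ne {m : Wall cs} {g : W} {b : B} (h : wallAt cs g b ≠ m) :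
    sep m (g * cs.simple b) = sep m g := by
  classical
  have := (exists_separation m).choose_spec.2 g b
  rwa [if_neg h, add_zero] at this

theorem IsCarrier.mem_wallAt {x : Davis cs} {g : W} {T : Spherical cs} (hT : IsCarrier x g T)
    {b : B} (hb : b ∈ T.1) : x ∈ (wallAt cs g b).1 := by
  rw [mem_wallAt_iff, hT.smul_eq_iff]
  simpa [mul_assoc] using simple_mem_parabolic hb

theorem IsCarrier.mem_chamber {x : Davis cs} {g : W} {T : Spherical cs} (hT : IsCarrier x g T) :
    x ∈ chamber cs g :=
  (hT.mem_chamber_iff g).2 (by simp)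

theorem IsCarrier.mul {x : Davis cs} {g : W} {T : Spherical cs} (hT : IsCarrier x g T) {u : W}
    (hu : u ∈ parabolic cs T.1) : IsCarrier x (g * u) T :=
  hT.translate ((hT.mem_chamber_iff _).2 (by simpa using hu))

/-- Two chambers that contain a point are joined by a gallery of chambers that contain it. -/
theorem IsCarrier.gallery_induction {x : Davis cs} {g : W} {T : Spherical cs}
    (hT : IsCarrier x g T) {P : W → Prop} (h1 : P g)
    (hmul : ∀ h b, IsCarrier x h T → b ∈ T.1 → P h → P (h * cs.simple b))
    {h : W} (hh : x ∈ chamber cs h) : P h := by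
  have key : ∀ u ∈ parabolic cs T.1, P (g * u) := by
    intro u hu
    unfold parabolic at hu
    induction hu using Subgroup.closure_induction_right with
    | one => simpa using h1
    | mul_right z hz y hy ih =>
      obtain ⟨b, hb, rfl⟩ := hy
      rw [← mul_assoc]
      exact hmul _ b (hT.mul hz) hb ih
    | mul_inv_cancel z hz y hy ih =>
      obtain ⟨b, hb, rfl⟩ := hy
      rw [cs.inv_simple, ← mul_assoc]
      exact hmul _ b (hT.mul hz) hb ih
  simpa using key _ ((hT.mem_chamber_iff h).1 hh)

/-- A gallery around x crosses only walls through x, so the side of a point off the wall is well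
defined. -/
theorem IsCarrier.sep_eq {x : Davis cs} {g h : W} {T : Spherical cs} (hT : IsCarrier x g T)
    {m : Wall cs} (hh : x ∈ chamber cs h) (hm : x ∉ m.1) : sep m h = sep m g := by
  refine hT.gallery_induction (P := fun h => sep m h = sep m g) rfl (fun k b hk hb ih => ?_) hh
  rw [sep_mul_simple_of_ne, ih]
  rintro rfl
  exact hm (hk.mem_wallAt hb)

theorem sep_eq_of_mem [Finite B] {x : Davis cs} {g h : W} {m : Wall cs} (hg : x ∈ chamber cs g)
    (hh : x ∈ chamber cs h) (hm : x ∉ m.1) : sep m h = sep m g := by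
  obtain ⟨T, hT⟩ := exists_carrier hg
  exact hT.sep_eq hh hm

theorem sep_wordProd_eq_zero (m : Wall cs) (ω : List B)
    (h : ∀ t ∈ cs.leftInvSeq ω, MulAction.fixedBy (Davis cs) t ≠ m.1) :
    sep m (cs.wordProd ω) = 0 := by
  induction ω using List.reverseRecOn with
  | nil => rw [cs.wordProd_nil, sep_one]
  | append_singleton ω b ih =>
    rw [← List.concat_eq_append, cs.leftInvSeq_concat] at h
    rw [← List.concat_eq_append, cs.wordProd_concat, sep_mul_simple_of_ne]
    · exact ih fun t ht => h t (by simp [ht])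
    · intro e
      exact h _ (by simp) (congrArg Subtype.val e)

/-- A reduced word crosses no wall twice, so its last wall has not been crossed before. -/
theorem sep_eq_zero_of_length {g : W} {b : B} (h : cs.length (g * cs.simple b) = cs.length g + 1) :
    sep (wallAt cs g b) g = 0 := by
  obtain ⟨ω, hω, rfl⟩ := cs.exists_isReduced g
  refine sep_wordProd_eq_zero _ _ fun t ht e => ?_
  have hred : cs.IsReduced (ω.concat b) := by
    rw [CoxeterSystem.IsReduced, cs.wordProd_concat, h, hω.eq]; simp
  have hnd := hred.nodup_leftInvSeq
  rw [cs.leftInvSeq_concat, List.concat_eq_append, List.nodup_append] at hnd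
  refine hnd.2.2 t ht _ (List.mem_singleton_self _) ?_
  rw [← faceVertex_mem_wall_iff (cs.isReflection_of_mem_leftInvSeq ω ht)]
  change _ ∈ MulAction.fixedBy (Davis cs) t
  rw [e]
  exact faceVertex_mem_wallAt _ _

/-- Induction along minimal galleries that start at the base chamber. -/
theorem gallery_induction (cs : CoxeterSystem M W) {P : W → Prop} (one : P 1)
    (step : ∀ g b, sep (wallAt cs g b) g = 0 → P g → P (g * cs.simple b)) (g : W) : P g := by
  induction hn : cs.length g using Nat.strong_induction_on generalizing g with
  | _ n ih =>
    by_cases hg : g = 1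
    · rwa [hg]
    · obtain ⟨b, hb⟩ := cs.exists_rightDescent_of_ne_one hg
      rw [cs.isRightDescent_iff] at hb
      have := step (g * cs.simple b) b (sep_eq_zero_of_length (by
        rw [cs.simple_mul_simple_cancel_right, hb])) (ih _ (by omega) _ rfl)
      rwa [cs.simple_mul_simple_cancel_right] at this

theorem zmod_two_cases (a : ZMod 2) : a = 0 ∨ a = 1 := by
  revert a; decide

/-- The wall crossed in a step of a minimal gallery separates the end of the step from the base
chamber, and no wall that separates the start is lost. -/
theorem sep_mul_simple_eq_zero {m : Wall cs} {g : W} {b : B} (h : sep (wallAt cs g b) g = 0)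
    (hm : sep m (g * cs.simple b) = 0) : wallAt cs g b ≠ m ∧ sep m g = 0 := by
  have hne : wallAt cs g b ≠ m := by
    rintro rfl
    rw [sep_mul_simple_self, h] at hm
    simp at hm
  exact ⟨hne, by rwa [sep_mul_simple_of_ne hne] at hm⟩

-- Counts only crossings of m on the base side of m'. Around a relator of finite order the chambers
-- share a vertex. If it is off m, nothing is counted; if it is on m, it is off m', so all or none
-- of the crossings of m are counted, and both totals are even.
open Classical in
theorem exists_part_potential {m m' : Wall cs} (hd : Disjoint m.1 m'.1) :
    ∃ χ : W → ZMod 2, χ 1 = 0 ∧ ∀ g b, χ (g * cs.simple b) =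
      χ g + if wallAt cs g b = m ∧ sep m' g = 0 then 1 else 0 := by
  refine exists_potential cs _ fun g i j => ?_
  by_cases h0 : M i j = 0
  · simp [h0]
  set a := cs.simple j * cs.simple i with ha
  let T : Spherical cs := ⟨{i, j}, parabolic_pair_finite cs i j h0⟩
  have hi : i ∈ T.1 := by simp [T]
  have hj : j ∈ T.1 := by simp [T]
  have hu : ∀ k, a ^ k ∈ parabolic cs T.1 := fun k =>
    pow_mem (mul_mem (simple_mem_parabolic hj) (simple_mem_parabolic hi)) k
  have hT := isCarrier_vertexPoint g T
  have h1 : ∀ k, IsCarrier (vertexPoint g T) (g * a ^ k) T := fun k => hT.mul (hu k)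
  have h2 : ∀ k, IsCarrier (vertexPoint g T) (g * a ^ k * cs.simple j) T := fun k =>
    (h1 k).mul (simple_mem_parabolic hj)
  by_cases hv : vertexPoint g T ∈ m.1
  · have hv' : vertexPoint g T ∉ m'.1 := fun h => disjoint_left.1 hd hv h
    have e1 : ∀ k, sep m' (g * a ^ k) = sep m' g := fun k =>
      hT.sep_eq (h1 k).mem_chamber hv'
    have e2 : ∀ k, sep m' (g * a ^ k * cs.simple j) = sep m' g := fun k =>
      hT.sep_eq (h2 k).mem_chamber hv'
    simp only [e1, e2]
    by_cases hs : sep m' g = 0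
    · simp only [hs, and_true]
      exact sum_wall_relator m g i j
    · simp [hs]
  · have n1 : ∀ k, wallAt cs (g * a ^ k) j ≠ m := by
      rintro k rfl; exact hv ((h1 k).mem_wallAt hj)
    have n2 : ∀ k, wallAt cs (g * a ^ k * cs.simple j) i ≠ m := by
      rintro k rfl; exact hv ((h2 k).mem_wallAt hi)
    simp [n1, n2]

/-- The reflection in a wall maps the chambers adjacent to it to chambers adjacent to it. -/
theorem wallAt_reflection_mul_iff (g k : W) (a c : B) :
    wallAt cs (g * cs.simple a * g⁻¹ * k) c = wallAt cs g a ↔ wallAt cs k c = wallAt cs g a := by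
  rw [wallAt_eq_iff, wallAt_eq_iff]
  set r := g * cs.simple a * g⁻¹ with hr
  have e : r * k * cs.simple c * (r * k)⁻¹ = r * (k * cs.simple c * k⁻¹) * r⁻¹ := by group
  rw [e]
  constructor
  · intro h
    calc k * cs.simple c * k⁻¹ = r⁻¹ * (r * (k * cs.simple c * k⁻¹) * r⁻¹) * r := by group
      _ = r := by rw [h]; group
  · intro h
    rw [h]; group

/-- If the wall had parts on both sides of m', the potential of the part on the base side would be
constant on the base half space and on its mirror image. The jump between them would be 1 when
computed at g and 0 when computed at h. -/
theorem sep_eq_zero_of_disjoint {m' : Wall cs} {g h : W} {a b : B}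
    (hd : Disjoint (wallAt cs g a).1 m'.1) (e : wallAt cs h b = wallAt cs g a)
    (hg : sep (wallAt cs g a) g = 0) (hh : sep (wallAt cs g a) h = 0)
    (hg' : sep m' g = 0) : sep m' h = 0 := by
  classical
  by_contra hh'
  obtain ⟨χ, h1, hχ⟩ := exists_part_potential hd
  set r := g * cs.simple a * g⁻¹ with hr
  have key : ∀ k, sep (wallAt cs g a) k = 0 → χ k = 0 ∧ χ (r * k) = χ r := by
    refine gallery_induction cs (by simp [h1]) fun k c hk ih hm => ?_
    obtain ⟨hne, hm'⟩ := sep_mul_simple_eq_zero hk hm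
    obtain ⟨ih1, ih2⟩ := ih hm'
    have hne' : wallAt cs (r * k) c ≠ wallAt cs g a := (wallAt_reflection_mul_iff g k a c).not.2 hne
    rw [← mul_assoc, hχ, hχ, if_neg fun h => hne h.1, if_neg fun h => hne' h.1, ih1, ih2]
    simp
  have eg : r * g = g * cs.simple a := by simp [hr]
  have eh : r * h = h * cs.simple b := by
    have := wallAt_eq_iff.1 e
    rw [hr, ← this]; simp
  have k1 := key g hg
  have k2 := key h hh
  rw [eg, hχ, if_pos ⟨rfl, hg'⟩, k1.1] at k1
  rw [eh, hχ, if_neg fun h => hh' h.2, k2.1] at k2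
  have := k1.2.trans k2.2.symm
  simp at this

theorem wall_nonempty (m : Wall cs) : m.1.Nonempty := by
  obtain ⟨g, b, rfl⟩ := exists_eq_wallAt m
  exact ⟨_, faceVertex_mem_wallAt g b⟩

/-- A wall lies on one side of each wall that is disjoint from it. -/
theorem sep_eq_of_disjoint {m' : Wall cs} {g h : W} {a b : B}
    (hd : Disjoint (wallAt cs g a).1 m'.1) (e : wallAt cs h b = wallAt cs g a) :
    sep m' h = sep m' g := by
  have hne : wallAt cs g a ≠ m' := by
    rintro rfl
    exact (wall_nonempty (wallAt cs g a)).ne_empty (disjoint_self.1 hd)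
  -- Crossing the wall does not change the side of m', so both chambers may be taken on the base
  -- side of the wall.
  have near : ∀ (k : W) (c : B), wallAt cs k c = wallAt cs g a →
      ∃ k', wallAt cs k' c = wallAt cs g a ∧ sep (wallAt cs g a) k' = 0 ∧
        sep m' k' = sep m' k := by
    intro k c hk
    rcases zmod_two_cases (sep (wallAt cs g a) k) with h0 | h0
    · exact ⟨k, hk, h0, rfl⟩
    · refine ⟨k * cs.simple c, by rw [wallAt_mul_simple, hk], ?_, ?_⟩
      · rw [← hk] at h0 ⊢
        rw [sep_mul_simple_self, h0]; rfl
      · exact sep_mul_simple_of_ne (hk ▸ hne)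
  obtain ⟨g', wg, sg, eg⟩ := near g a rfl
  obtain ⟨h', wh, sh, eh⟩ := near h b e
  rw [← eg, ← eh]
  rw [← wg] at hd sg sh wh
  have h1 : sep m' g' = 0 → sep m' h' = 0 := sep_eq_zero_of_disjoint hd wh sg sh
  have h2 : sep m' h' = 0 → sep m' g' = 0 := by
    rw [← wh] at hd sg sh
    exact sep_eq_zero_of_disjoint hd wh.symm sh sg
  rcases zmod_two_cases (sep m' g') with p | p <;> rcases zmod_two_cases (sep m' h') with q | q
  · rw [p, q]
  · rw [p, h1 p]
  · rw [q, h2 q]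
  · rw [p, q]

end Separation

/-! ### Half spaces, components and cone points -/

section Topology

variable {B W : Type*} [Group W] {M : CoxeterMatrix B} {cs : CoxeterSystem M W}

theorem continuous_coord (v : Vertex cs) : Continuous fun x : Davis cs => x.coord v :=
  (continuous_apply v).comp continuous_induced_dom

theorem isClosed_wall (m : Wall cs) : IsClosed m.1 := by
  obtain ⟨m, r, hr, rfl⟩ := m
  have : MulAction.fixedBy (Davis cs) r =
      ⋂ v : Vertex cs, {x : Davis cs | x.coord (r⁻¹ • v) = x.coord v} := by
    ext x
    simp only [MulAction.mem_fixedBy, mem_iInter, mem_ofPred_eq]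
    exact ⟨fun h v => by rw [← smul_coord, h], fun h => Davis.ext (funext h)⟩
  change IsClosed (MulAction.fixedBy (Davis cs) r)
  rw [this]
  exact isClosed_iInter fun v => isClosed_eq (continuous_coord _) (continuous_coord _)

theorem exists_mem_chamber (x : Davis cs) : ∃ g, x ∈ chamber cs g := by
  obtain ⟨g, c, -, hs⟩ := x.isSimplex_support
  exact ⟨g, hs.subset.trans (image_subset_range _ _)⟩

theorem finite_support [Finite B] (x : Davis cs) : (support x.coord).Finite := by
  obtain ⟨g, hg⟩ := exists_mem_chamber x
  exact (finite_range _).subset hg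

/-- The points off a wall that lie in the chambers separated from the base chamber, or in the
chambers not separated from it. -/
def halfSpace (m : Wall cs) (e : ZMod 2) : Set (Davis cs) :=
  {x | x ∉ m.1 ∧ ∃ g, x ∈ chamber cs g ∧ sep m g = e}

theorem mem_halfSpace_iff [Finite B] {m : Wall cs} {e : ZMod 2} {x : Davis cs} {g : W}
    (hm : x ∉ m.1) (hg : x ∈ chamber cs g) : x ∈ halfSpace m e ↔ sep m g = e := by
  constructor
  · rintro ⟨-, h, hh, rfl⟩
    exact sep_eq_of_mem hh hg hm
  · intro h
    exact ⟨hm, g, hg, h⟩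

theorem isOpen_halfSpace [Finite B] (m : Wall cs) (e : ZMod 2) : IsOpen (halfSpace m e) := by
  rw [isOpen_iff_mem_nhds]
  rintro x hx
  -- In the open star of x, every chamber that contains y also contains x.
  have hstar : (⋂ v ∈ support x.coord, {y : Davis cs | 0 < y.coord v}) ∩ (m.1)ᶜ ∈ nhds x := by
    refine IsOpen.mem_nhds (IsOpen.inter ?_ (isClosed_wall m).isOpen_compl) ⟨?_, hx.1⟩
    · exact (finite_support x).isOpen_biInter fun v _ =>
        isOpen_lt continuous_const (continuous_coord v)
    · simp only [mem_iInter, mem_ofPred_eq]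
      exact fun v hv => lt_of_le_of_ne (x.coord_nonneg v) (Ne.symm hv)
  refine Filter.mem_of_superset hstar ?_
  rintro y ⟨hy, hym⟩
  simp only [mem_iInter, mem_ofPred_eq] at hy
  obtain ⟨g, hg⟩ := exists_mem_chamber y
  have hxg : x ∈ chamber cs g := fun v hv => hg (hy v hv).ne'
  rw [mem_halfSpace_iff hym hg, ← mem_halfSpace_iff hx.1 hxg]
  exact hx

theorem disjoint_halfSpace [Finite B] (m : Wall cs) :
    Disjoint (halfSpace m 0) (halfSpace m 1) := by
  rw [disjoint_left]
  rintro x h0 ⟨hm, g, hg, h1⟩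
  rw [mem_halfSpace_iff hm hg, h1] at h0
  exact one_ne_zero h0

theorem compl_wall_subset (m : Wall cs) : (m.1)ᶜ ⊆ halfSpace m 0 ∪ halfSpace m 1 := by
  intro x hx
  obtain ⟨g, hg⟩ := exists_mem_chamber x
  rcases zmod_two_cases (sep m g) with h | h
  · exact Or.inl ⟨hx, g, hg, h⟩
  · exact Or.inr ⟨hx, g, hg, h⟩

/-- The cone point of the chamber `g C`. -/
def conePoint (cs : CoxeterSystem M W) (g : W) : Davis cs := vertexPoint g (coneVertex cs)

theorem isCarrier_coneVertex_iff {x : Davis cs} {g : W} : IsCarrier x g (coneVertex cs) ↔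
    x ∈ chamber cs g ∧ vertex g (coneVertex cs) ∈ support x.coord := by
  refine ⟨fun h => ⟨h.mem_chamber, h.1⟩, fun ⟨h1, h2⟩ => ⟨h2, fun v hv => ?_⟩⟩
  obtain ⟨T, rfl⟩ := h1 hv
  exact ⟨T, empty_subset T.1, rfl⟩

theorem notMem_wall_of_isCarrier {x : Davis cs} {g : W} (hx : IsCarrier x g (coneVertex cs))
    (m : Wall cs) : x ∉ m.1 := by
  obtain ⟨h, b, rfl⟩ := exists_eq_wallAt m
  rw [mem_wallAt_iff, hx.smul_eq_iff]
  change ¬ _ ∈ parabolic cs ∅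
  rw [parabolic_empty, Subgroup.mem_bot]
  intro e
  have hr : cs.IsReflection (g⁻¹ * (h * cs.simple b * h⁻¹) * g) :=
    ⟨g⁻¹ * h, b, by group⟩
  have := hr.odd_length
  simp [e] at this

/-- A chamber is star-shaped with respect to its cone point. -/
theorem exists_segment [Finite B] {x : Davis cs} {g : W} (hx : x ∈ chamber cs g) :
    ∃ γ : ℝ → Davis cs, Continuous γ ∧ γ 0 = x ∧ γ 1 = conePoint cs g ∧
      ∀ t ∈ Ioc (0 : ℝ) 1, IsCarrier (γ t) g (coneVertex cs) := by
  set p := conePoint cs g with hp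
  have hsp : support p.coord = {vertex g (coneVertex cs)} := support_vertexPoint g _
  obtain ⟨c, hc, hs⟩ := exists_support_eq hx
  have hsub : ∀ t : ℝ, (support fun v => (1 - t) * x.coord v + t * p.coord v) ⊆
      vertex g '' insert (coneVertex cs) c := by
    intro t v hv
    by_contra h
    rw [image_insert_eq, mem_insert_iff, not_or, ← hs, ← mem_singleton_iff, ← hsp,
      notMem_support, notMem_support] at h
    exact hv (by simp [h.1, h.2])
  have hchain : IsChain (· ≤ ·) (insert (coneVertex cs) c) :=
    hc.insert fun T _ _ => Or.inl (empty_subset T.1)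
  let γ : unitInterval → Davis cs := fun t =>
    { coord := fun v => (1 - (t : ℝ)) * x.coord v + t * p.coord v
      coord_nonneg := fun v => add_nonneg
        (mul_nonneg (sub_nonneg.2 t.2.2) (x.coord_nonneg v)) (mul_nonneg t.2.1 (p.coord_nonneg v))
      isSimplex_support := by
        obtain ⟨c', hc', e⟩ := subset_image_iff.1 (hsub t)
        exact ⟨g, c', hchain.mono hc', e.symm⟩
      sum_coord := by
        rw [finsum_add_distrib, ← mul_finsum, ← mul_finsum, x.sum_coord, p.sum_coord]
        · ring
        · exact (finite_support x).subset (support_mul_subset_right _ _)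
        · exact (finite_support p).subset (support_mul_subset_right _ _) }
  have hγ : Continuous γ := by
    refine continuous_induced_rng.2 (continuous_pi fun v => ?_)
    change Continuous fun t : unitInterval => (1 - (t : ℝ)) * x.coord v + t * p.coord v
    fun_prop
  refine ⟨fun t => γ (projIcc 0 1 zero_le_one t), hγ.comp continuous_projIcc, ?_, ?_, ?_⟩
  · ext v
    simp [γ]
  · ext v
    simp [γ]
  · intro t ht
    beta_reduce
    rw [projIcc_of_mem _ ⟨ht.1.le, ht.2⟩, isCarrier_coneVertex_iff]
    refine ⟨(hsub t).trans (image_subset_range _ _), ?_⟩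
    change (1 - t) * x.coord _ + t * p.coord _ ≠ 0
    have h1 : p.coord (vertex g (coneVertex cs)) = 1 := by
      simp [hp, conePoint, vertexPoint]
    rw [h1]
    have := mul_nonneg (sub_nonneg.2 ht.2) (x.coord_nonneg (vertex g (coneVertex cs)))
    linarith [ht.1]

theorem connectedComponentIn_conePoint [Finite B] {U : Set (Davis cs)} {g : W}
    (hU : ∀ y, IsCarrier y g (coneVertex cs) → y ∈ U) {x : Davis cs} (hx : x ∈ chamber cs g)
    (hxU : x ∈ U) : connectedComponentIn U x = connectedComponentIn U (conePoint cs g) := by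
  obtain ⟨γ, hγ, h0, h1, hmem⟩ := exists_segment hx
  refine connectedComponentIn_eq ?_
  have hpre : IsPreconnected (γ '' Icc 0 1) := isPreconnected_Icc.image _ hγ.continuousOn
  refine hpre.subset_connectedComponentIn ⟨0, by simp, h0⟩ ?_ ⟨1, by simp, h1⟩
  rintro _ ⟨t, ht, rfl⟩
  rcases ht.1.eq_or_lt with rfl | h
  · rwa [h0]
  · exact hU _ (hmem t ⟨h, ht.2⟩)

theorem mem_closure_connectedComponentIn [Finite B] {U : Set (Davis cs)} {g : W}
    (hU : ∀ y, IsCarrier y g (coneVertex cs) → y ∈ U) {x : Davis cs} (hx : x ∈ chamber cs g) :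
    x ∈ closure (connectedComponentIn U (conePoint cs g)) := by
  obtain ⟨γ, hγ, h0, h1, hmem⟩ := exists_segment hx
  have hpre : IsPreconnected (γ '' Ioc 0 1) := isPreconnected_Ioc.image _ hγ.continuousOn
  have hsub : γ '' Ioc 0 1 ⊆ connectedComponentIn U (conePoint cs g) := by
    refine hpre.subset_connectedComponentIn ⟨1, by simp, h1⟩ ?_
    rintro _ ⟨t, ht, rfl⟩
    exact hU _ (hmem t ht)
  refine closure_mono hsub (image_closure_subset_closure_image hγ ⟨0, ?_, h0⟩)
  rw [closure_Ioc zero_ne_one]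
  simp

theorem mem_compl_iUnion {R : Set (Wall cs)} {x : Davis cs} :
    x ∈ (⋃ m ∈ R, m.1)ᶜ ↔ ∀ m ∈ R, x ∉ m.1 := by simp

theorem mem_compl_iUnion_of_isCarrier (R : Set (Wall cs)) {g : W} (y : Davis cs)
    (hy : IsCarrier y g (coneVertex cs)) : y ∈ (⋃ m ∈ R, m.1)ᶜ :=
  mem_compl_iUnion.2 fun m _ => notMem_wall_of_isCarrier hy m

theorem conePoint_mem_compl (R : Set (Wall cs)) (g : W) : conePoint cs g ∈ (⋃ m ∈ R, m.1)ᶜ :=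
  mem_compl_iUnion_of_isCarrier R _ (isCarrier_vertexPoint g _)

theorem conePoint_one_mem (R : Set (Wall cs)) : conePoint cs 1 ∈ baseComponent cs R :=
  mem_connectedComponentIn (conePoint_mem_compl R 1)

/-- The path through the midpoint of the common face meets no wall except possibly that of the face.
-/
theorem conePoint_mul_simple_mem [Finite B] {R : Set (Wall cs)} {g : W} {b : B}
    (hb : wallAt cs g b ∉ R) (hg : conePoint cs g ∈ baseComponent cs R) :
    conePoint cs (g * cs.simple b) ∈ baseComponent cs R := by
  have hf : vertexPoint g (faceVertex cs b) ∈ (⋃ m ∈ R, m.1)ᶜ :=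
    mem_compl_iUnion.2 fun m hm h => hb (eq_wallAt_of_faceVertex_mem h ▸ hm)
  have e1 := connectedComponentIn_conePoint (mem_compl_iUnion_of_isCarrier R)
    (vertexPoint_mem_chamber g (faceVertex cs b)) hf
  have e2 := connectedComponentIn_conePoint (mem_compl_iUnion_of_isCarrier R)
    (vertexPoint_faceVertex g b ▸ vertexPoint_mem_chamber (g * cs.simple b) (faceVertex cs b)) hf
  rw [baseComponent, connectedComponentIn_eq hg, ← e1, e2]
  exact mem_connectedComponentIn (conePoint_mem_compl R _)

theorem baseComponent_subset_halfSpace [Finite B] {R : Set (Wall cs)} {m : Wall cs} (hm : m ∈ R) :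
    baseComponent cs R ⊆ halfSpace m 0 := by
  refine isPreconnected_connectedComponentIn.subset_left_of_subset_union (isOpen_halfSpace m 0)
    (isOpen_halfSpace m 1) (disjoint_halfSpace m) ?_ ⟨conePoint cs 1, conePoint_one_mem R, ?_⟩
  · refine (connectedComponentIn_subset _ _).trans (Subset.trans ?_ (compl_wall_subset m))
    exact compl_subset_compl.2 (subset_biUnion_of_mem (u := fun m : Wall cs => m.1) hm)
  · exact ⟨notMem_wall_of_isCarrier (isCarrier_vertexPoint 1 _) m, 1,
      vertexPoint_mem_chamber 1 _, sep_one m⟩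

theorem baseSide_eq (m : Wall cs) : baseSide cs m = baseComponent cs {m} := by
  simp [baseSide, baseComponent]

theorem conePoint_mem_baseSide [Finite B] (m : Wall cs) (g : W) (h : sep m g = 0) :
    conePoint cs g ∈ baseSide cs m := by
  rw [baseSide_eq]
  revert h
  refine gallery_induction cs (P := fun g => sep m g = 0 → conePoint cs g ∈ baseComponent cs {m})
    (fun _ => conePoint_one_mem _) (fun k b hk ih hm => ?_) g
  obtain ⟨hne, h0⟩ := sep_mul_simple_eq_zero hk hm
  exact conePoint_mul_simple_mem hne (ih h0)

theorem notMem_wall_of_mem_openChamber [Finite B] {x : Davis cs} {g : W}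
    (hx : x ∈ openChamber cs g) (m : Wall cs) : x ∉ m.1 := by
  obtain ⟨T, hT⟩ := exists_carrier hx.1
  have hT0 : T = coneVertex cs := by
    refine Subtype.ext (eq_empty_iff_forall_notMem.2 fun b hb => hx.2 ?_)
    exact mem_iUnion.2 ⟨b, hx.1, hT.mem_wallAt hb⟩
  exact notMem_wall_of_isCarrier (hT0 ▸ hT) m

theorem conePoint_mem_openChamber (g : W) : conePoint cs g ∈ openChamber cs g := by
  refine ⟨vertexPoint_mem_chamber g _, ?_⟩
  simp only [mem_iUnion, not_exists]
  exact fun b h => notMem_wall_of_isCarrier (isCarrier_vertexPoint g _) _ h.2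

theorem mem_baseSide_iff [Finite B] {x : Davis cs} {g : W} (hx : x ∈ openChamber cs g)
    (m : Wall cs) : x ∈ baseSide cs m ↔ sep m g = 0 := by
  have hm := notMem_wall_of_mem_openChamber hx m
  constructor
  · intro h
    rw [baseSide_eq] at h
    exact (mem_halfSpace_iff hm hx.1).1 (baseComponent_subset_halfSpace (mem_singleton m) h)
  · intro h
    have hc := conePoint_mem_baseSide m g h
    have hU : ∀ y, IsCarrier y g (coneVertex cs) → y ∈ (m.1)ᶜ :=
      fun y hy => notMem_wall_of_isCarrier hy m
    rw [baseSide, connectedComponentIn_eq hc, ← connectedComponentIn_conePoint hU hx.1 hm]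
    exact mem_connectedComponentIn hm

/-- This replaces the topological definition of the labels by crossing parity. -/
theorem openChamber_subset_left_iff [Finite B] (σ : Orientation cs) (m : Wall cs) (g : W) :
    openChamber cs g ⊆ σ.left m ↔ (σ m = 1 ↔ sep m g = 0) := by
  have hc := mem_baseSide_iff (conePoint_mem_openChamber (cs := cs) g) m
  unfold Orientation.left
  split_ifs with hσ
  · simp only [hσ, true_iff]
    exact ⟨fun h => hc.1 (h (conePoint_mem_openChamber g)),
      fun h x hx => (mem_baseSide_iff hx m).2 h⟩
  · simp only [hσ, false_iff]
    exact ⟨fun h => fun h0 => (h (conePoint_mem_openChamber g)).2 (hc.2 h0),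
      fun h x hx => ⟨notMem_wall_of_mem_openChamber hx m, fun hb =>
        h ((mem_baseSide_iff hx m).1 hb)⟩⟩

end Topology

/-! ### Depth of chambers and level of walls -/

section Depth

variable {B W F : Type*} [Group W] {M : CoxeterMatrix B} {cs : CoxeterSystem M W}

/-- A gallery and its mirror image cross the wall at the same steps, so the parities keep the
difference they have at g. -/
theorem sep_reflection_mul (g : W) (a : B) (k : W) :
    sep (wallAt cs g a) (g * cs.simple a * g⁻¹ * k) = sep (wallAt cs g a) k + 1 := by
  have key : ∀ u : W, sep (wallAt cs g a) (g * cs.simple a * g⁻¹ * (g * u)) =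
      sep (wallAt cs g a) (g * u) + 1 := by
    intro u
    induction u using cs.simple_induction_right with
    | one => simpa using sep_mul_simple_self g a
    | mul_simple_right u b ih =>
      rw [← mul_assoc g u, ← mul_assoc _ (g * u)]
      have hiff := wallAt_reflection_mul_iff (cs := cs) g (g * u) a b
      by_cases h : wallAt cs (g * u) b = wallAt cs g a
      · have h1 := sep_mul_simple_self (cs := cs) (g * u) b
        have h2 := sep_mul_simple_self (cs := cs) (g * cs.simple a * g⁻¹ * (g * u)) b
        rw [h] at h1
        rw [hiff.2 h] at h2
        rw [h1, h2, ih]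
      · rw [sep_mul_simple_of_ne h, sep_mul_simple_of_ne (hiff.not.2 h), ih]
  simpa using key (g⁻¹ * k)

/-- Each point of a wall lies in a chamber that is adjacent to the wall. -/
theorem exists_chamber_of_mem_wall [Finite B] {x : Davis cs} {m : Wall cs} (hx : x ∈ m.1) :
    ∃ k b, x ∈ chamber cs k ∧ wallAt cs k b = m := by
  by_contra! hcon
  obtain ⟨g, a, rfl⟩ := exists_eq_wallAt m
  obtain ⟨k, hk⟩ := exists_mem_chamber x
  obtain ⟨T, hT⟩ := exists_carrier hk
  have hr := smul_mem_chamber hk (g * cs.simple a * g⁻¹)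
  rw [mem_wallAt_iff.1 hx] at hr
  -- Both k and its mirror image contain x, so a gallery around x would join the two sides without
  -- crossing the wall.
  have := hT.gallery_induction
    (P := fun h => sep (wallAt cs g a) h = sep (wallAt cs g a) k) rfl
    (fun h b hh _ ih => (sep_mul_simple_of_ne (hcon h b hh.mem_chamber)).trans ih) hr
  rw [sep_reflection_mul] at this
  simp at this

/-- The walls of a given color that separate a chamber from the base chamber. -/
def separators (φ : Wall cs → F) (c : F) (g : W) : Set (Wall cs) := {m | φ m = c ∧ sep m g = 1}

theorem separators_one (φ : Wall cs → F) (c : F) : separators φ c 1 = ∅ := by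
  ext m
  simp [separators, sep_one]

theorem separators_mul_simple_of_ne {φ : Wall cs → F} {c : F} {g : W} {b : B}
    (h : φ (wallAt cs g b) ≠ c) : separators φ c (g * cs.simple b) = separators φ c g := by
  ext m
  simp only [separators, mem_ofPred_eq]
  refine and_congr_right fun hm => ?_
  rw [sep_mul_simple_of_ne]
  rintro rfl
  exact h hm

theorem separators_mul_simple_of_eq {φ : Wall cs → F} {c : F} {g : W} {b : B}
    (h : φ (wallAt cs g b) = c) (h0 : sep (wallAt cs g b) g = 0) :
    separators φ c (g * cs.simple b) = insert (wallAt cs g b) (separators φ c g) := by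
  ext m
  simp only [separators, mem_ofPred_eq, mem_insert_iff]
  by_cases hm : wallAt cs g b = m
  · subst hm
    simp [h, sep_mul_simple_self, h0]
  · rw [sep_mul_simple_of_ne hm]
    simp [Ne.symm hm]

theorem finite_separators (φ : Wall cs → F) (c : F) (g : W) : (separators φ c g).Finite := by
  refine gallery_induction cs (P := fun g => (separators φ c g).Finite)
    (by rw [separators_one]; exact finite_empty)
    (fun k b hk ih => ?_) g
  by_cases h : φ (wallAt cs k b) = c
  · rw [separators_mul_simple_of_eq h hk]
    exact ih.insert _
  · rwa [separators_mul_simple_of_ne h]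

/-- The number of walls of a given color that separate a chamber from the base chamber. -/
def depth (φ : Wall cs → F) (c : F) (g : W) : ℕ := (separators φ c g).ncard

theorem depth_one (φ : Wall cs → F) (c : F) : depth φ c 1 = 0 := by
  rw [depth, separators_one, ncard_empty]

theorem depth_mul_simple_of_ne {φ : Wall cs → F} {c : F} {g : W} {b : B}
    (h : φ (wallAt cs g b) ≠ c) : depth φ c (g * cs.simple b) = depth φ c g := by
  rw [depth, separators_mul_simple_of_ne h, depth]

theorem depth_mul_simple_of_eq {φ : Wall cs → F} {c : F} {g : W} {b : B}
    (h : φ (wallAt cs g b) = c) (h0 : sep (wallAt cs g b) g = 0) :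
    depth φ c (g * cs.simple b) = depth φ c g + 1 := by
  rw [depth, separators_mul_simple_of_eq h h0, ncard_insert_of_notMem _ (finite_separators φ c g),
    depth]
  rintro ⟨-, h1⟩
  rw [h0] at h1
  exact zero_ne_one h1

/-- A chamber of positive depth is separated from the base chamber by a wall of the color that is
adjacent to a chamber whose depth is smaller by one. -/
theorem exists_separator {φ : Wall cs → F} {c : F} (g : W) (hg : 0 < depth φ c g) :
    ∃ h b, sep (wallAt cs h b) h = 0 ∧ φ (wallAt cs h b) = c ∧ depth φ c h + 1 = depth φ c g ∧
      sep (wallAt cs h b) g = 1 := by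
  revert hg
  refine gallery_induction cs (P := fun g => 0 < depth φ c g → ∃ h b, sep (wallAt cs h b) h = 0 ∧
    φ (wallAt cs h b) = c ∧ depth φ c h + 1 = depth φ c g ∧ sep (wallAt cs h b) g = 1)
    (fun h => absurd h (by rw [depth_one]; exact lt_irrefl 0)) (fun k b hk ih hpos => ?_) g
  -- The separator is the last wall of color c crossed by a minimal gallery.
  by_cases hc : φ (wallAt cs k b) = c
  · exact ⟨k, b, hk, hc, (depth_mul_simple_of_eq hc hk).symm, by
      rw [sep_mul_simple_self, hk, zero_add]⟩
  · rw [depth_mul_simple_of_ne hc] at hpos ⊢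
    obtain ⟨h, a, h0, ha, hd, h1⟩ := ih hpos
    refine ⟨h, a, h0, ha, hd, ?_⟩
    rwa [sep_mul_simple_of_ne]
    intro e
    exact hc (e ▸ ha)

/-- The chambers of small depth lie in the base component of the complement of the walls adjacent
to chambers of larger depth. -/
theorem conePoint_mem_of_depth_le [Finite B] {φ : Wall cs → F} {c : F} {R : Set (Wall cs)} {n : ℕ}
    (hR : ∀ g b, sep (wallAt cs g b) g = 0 → wallAt cs g b ∈ R →
      φ (wallAt cs g b) = c ∧ n ≤ depth φ c g) (g : W) (hg : depth φ c g ≤ n) :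
    conePoint cs g ∈ baseComponent cs R := by
  revert hg
  refine gallery_induction cs (P := fun g => depth φ c g ≤ n → conePoint cs g ∈ baseComponent cs R)
    (fun _ => conePoint_one_mem R) (fun k b hk ih hle => ?_) g
  by_cases hc : φ (wallAt cs k b) = c
  · rw [depth_mul_simple_of_eq hc hk] at hle
    exact conePoint_mul_simple_mem (fun hm => by have := (hR k b hk hm).2; omega) (ih (by omega))
  · rw [depth_mul_simple_of_ne hc] at hle
    exact conePoint_mul_simple_mem (fun hm => hc (hR k b hk hm).1) (ih hle)

variable [Finite B] {φ : Wall cs → F}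
  (hφ : ∀ m n : Wall cs, m ≠ n → φ m = φ n → Disjoint m.1 n.1)
include hφ

/-- A wall adjacent to a chamber of larger depth does not bound the base component. -/
theorem disjoint_closure_baseComponent {R : Set (Wall cs)} {n : ℕ} {g : W} {b : B}
    (hR : ∀ h a, sep (wallAt cs h a) h = 0 → φ (wallAt cs h a) = φ (wallAt cs g b) →
      n ≤ depth φ (φ (wallAt cs g b)) h → wallAt cs h a ∈ R)
    (h0 : sep (wallAt cs g b) g = 0) (hn : n + 1 ≤ depth φ (φ (wallAt cs g b)) g) :
    Disjoint (wallAt cs g b).1 (closure (baseComponent cs R)) := by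
  obtain ⟨h, a, ha, hc, hd, h1⟩ :=
    exists_separator (φ := φ) (c := φ (wallAt cs g b)) g (by omega)
  have hm' := hR h a ha hc (by omega)
  set m' := wallAt cs h a
  have hdisj : Disjoint (wallAt cs g b).1 m'.1 := by
    refine hφ _ _ ?_ hc.symm
    intro e
    rw [e, h1] at h0
    exact one_ne_zero h0
  have hcl : Disjoint (halfSpace m' 1) (closure (baseComponent cs R)) :=
    (((disjoint_halfSpace m').mono_left
      (baseComponent_subset_halfSpace hm')).closure_left (isOpen_halfSpace m' 1)).symm
  rw [disjoint_left]
  intro x hx hxc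
  obtain ⟨k, b', hk, e⟩ := exists_chamber_of_mem_wall hx
  refine disjoint_left.1 hcl ⟨disjoint_left.1 hdisj hx, k, hk, ?_⟩ hxc
  rw [sep_eq_of_disjoint hdisj e, h1]

/-- After n steps the base component reaches exactly far enough to touch the walls whose near
chambers have depth n. Deeper walls are shielded by a remaining wall of the same color, from which
they are disjoint. -/
theorem mem_remaining_iff (c : F) (n : ℕ) (g : W) (b : B) (h0 : sep (wallAt cs g b) g = 0) :
    wallAt cs g b ∈ remaining φ c n ↔ φ (wallAt cs g b) = c ∧ n ≤ depth φ c g := by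
  induction n generalizing g b with
  | zero => simp [remaining]
  | succ n ih =>
    simp only [remaining, mem_ofPred_eq, ih g b h0, not_nonempty_iff_eq_empty,
      ← disjoint_iff_inter_eq_empty]
    constructor
    · rintro ⟨⟨hc, hn⟩, hd⟩
      refine ⟨hc, ?_⟩
      by_contra hlt
      have hmem := conePoint_mem_of_depth_le (fun g b h0 => (ih g b h0).1) g
        (show depth φ c g ≤ n by omega)
      refine disjoint_left.1 hd (faceVertex_mem_wallAt g b) ?_
      rw [baseComponent, connectedComponentIn_eq hmem]
      exact mem_closure_connectedComponentIn (mem_compl_iUnion_of_isCarrier _)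
        (vertexPoint_mem_chamber g _)
    · rintro ⟨rfl, hn⟩
      exact ⟨⟨rfl, by omega⟩, disjoint_closure_baseComponent hφ
        (fun h a h0 hc hle => (ih h a h0).2 ⟨hc, hle⟩) h0 hn⟩

theorem level_wallAt (g : W) (b : B) (h0 : sep (wallAt cs g b) g = 0) :
    level φ (wallAt cs g b) = depth φ (φ (wallAt cs g b)) g + 1 := by
  have : {n | wallAt cs g b ∉ remaining φ (φ (wallAt cs g b)) n} =
      Ici (depth φ (φ (wallAt cs g b)) g + 1) := by
    ext n
    change ¬ wallAt cs g b ∈ remaining φ (φ (wallAt cs g b)) n ↔ _ ≤ n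
    rw [mem_remaining_iff hφ _ n g b h0, and_iff_right rfl, not_le, Nat.lt_iff_add_one_le]
  rw [level, this]
  exact csInf_Ici

/-- All faces of a color `c` of a chamber have the same sign, which alternates with the depth of
the chamber. -/
theorem resolution_label (ε : F → ℤˣ) (g : W) (b : B) :
    (resolution φ (alternating φ ε)).label g b =
      (φ (wallAt cs g b), -ε (φ (wallAt cs g b)) * (-1) ^ depth φ (φ (wallAt cs g b)) g) := by
  simp only [resolution, openChamber_subset_left_iff, Prod.mk.injEq, true_and]
  rcases zmod_two_cases (sep (wallAt cs g b) g) with h | h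
  · have hσ : alternating φ ε (wallAt cs g b) =
        -ε (φ (wallAt cs g b)) * (-1) ^ depth φ (φ (wallAt cs g b)) g := by
      rw [alternating, level_wallAt hφ g b h, pow_succ]; simp
    rw [hσ, h]
    rcases Int.units_eq_one_or (-ε (φ (wallAt cs g b)) * (-1) ^ depth φ (φ (wallAt cs g b)) g) with
      e | e <;> simp [e]
  -- On the far side the level equals the depth of g itself. This extra sign cancels the change from
  -- left to right.
  · have h0 : sep (wallAt cs (g * cs.simple b) b) (g * cs.simple b) = 0 := by
      rw [wallAt_mul_simple, sep_mul_simple_self, h]; rfl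
    have hl := level_wallAt hφ _ b h0
    have hd := depth_mul_simple_of_eq (φ := φ) rfl h0
    rw [cs.simple_mul_simple_cancel_right] at hd
    rw [← hd, wallAt_mul_simple] at hl
    have hσ : alternating φ ε (wallAt cs g b) =
        - (-ε (φ (wallAt cs g b)) * (-1) ^ depth φ (φ (wallAt cs g b)) g) := by
      rw [alternating, hl]; simp
    rw [hσ, h]
    rcases Int.units_eq_one_or (-ε (φ (wallAt cs g b)) * (-1) ^ depth φ (φ (wallAt cs g b)) g) with
      e | e <;> simp [e]

end Depth

/-! ### Strict balance and limit tilings -/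

section Balance

variable {B W F : Type*} [Group W] {M : CoxeterMatrix B} {cs : CoxeterSystem M W}

/-- If the faces of a color of a chamber have the same sign, which is reversed exactly when a face
of this color is crossed, then a tile of positive weight is found in a bounded number of steps. -/
theorem exists_pos_tile [Fintype B] [Finite F] {κ : W → B → F} {s : F → W → ℤˣ}
    (hκ : ∀ g b, κ (g * cs.simple b) b = κ g b)
    (hs : ∀ g b, s (κ g b) (g * cs.simple b) = -s (κ g b) g)
    (hs' : ∀ g b c, κ g b ≠ c → s c (g * cs.simple b) = s c g)
    {w : SignedColor F → ℤ} (hw : ∀ f, w (opp f) = -w f) (g : W)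
    (hne : ∃ b, w (κ g b, s (κ g b) g) ≠ 0) :
    ∃ l : List B, l.length ≤ {c | w (c, s c g) < 0}.ncard ∧
      0 < ∑ b, w (κ (g * cs.wordProd l) b, s (κ (g * cs.wordProd l) b) (g * cs.wordProd l)) := by
  induction hn : {c | w (c, s c g) < 0}.ncard generalizing g with
  | zero =>
    have hempty := (ncard_eq_zero (toFinite _)).1 hn
    refine ⟨[], le_rfl, ?_⟩
    rw [cs.wordProd_nil, mul_one]
    have h0 : ∀ b, 0 ≤ w (κ g b, s (κ g b) g) := fun b =>
      not_lt.1 fun h => (hempty ▸ (show κ g b ∈ {c | w (c, s c g) < 0} from h) : κ g b ∈ (∅ : Set F))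
    obtain ⟨b, hb⟩ := hne
    exact Finset.sum_pos' (fun b _ => h0 b) ⟨b, Finset.mem_univ b, lt_of_le_of_ne (h0 b) hb.symm⟩
  | succ n ih =>
    by_cases hneg : ∃ b, w (κ g b, s (κ g b) g) < 0
    · obtain ⟨b, hb⟩ := hneg
      have hflip : w (κ g b, s (κ g b) (g * cs.simple b)) = -w (κ g b, s (κ g b) g) := by
        rw [hs, ← hw]; rfl
      have hset : {c | w (c, s c (g * cs.simple b)) < 0} = {c | w (c, s c g) < 0} \ {κ g b} := by
        ext c
        simp only [mem_ofPred_eq, mem_sdiff, mem_singleton_iff]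
        by_cases hc : κ g b = c
        · subst hc
          rw [hflip]
          simp [hb.le]
        · rw [hs' g b c hc]
          simp [Ne.symm hc]
      -- The face just crossed now has positive weight, so the new tile still has a face of nonzero
      -- weight.
      obtain ⟨l, hl, hpos⟩ := ih (g * cs.simple b) ⟨b, by rw [hκ, hflip]; omega⟩ (by
        rw [hset, ncard_sdiff_singleton_of_mem (show κ g b ∈ {c | w (c, s c g) < 0} from hb), hn,
          Nat.add_sub_cancel])
      refine ⟨b :: l, by simpa using hl, ?_⟩
      rwa [cs.wordProd_cons, ← mul_assoc]
    · push Not at hneg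
      obtain ⟨b, hb⟩ := hne
      refine ⟨[], Nat.zero_le _, ?_⟩
      rw [cs.wordProd_nil, mul_one]
      exact Finset.sum_pos' (fun b _ => hneg b)
        ⟨b, Finset.mem_univ b, lt_of_le_of_ne (hneg b) hb.symm⟩

/-- A limit tiling agrees on each finite set of chambers with a translate. -/
theorem Tiled.IsLimitOf.exists_translate [Finite B] {β τ : Tiled B W F} (h : β.IsLimitOf τ)
    {Φ : Set W} (hΦ : Φ.Finite) : ∃ k : W, ∀ g ∈ Φ, β.label g = τ.label (k * g) := by
  let _ : TopologicalSpace (SignedColor F) := ⊥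
  have : DiscreteTopology (SignedColor F) := ⟨rfl⟩
  have hcont : ∀ g b, Continuous fun σ : Tiled B W F => σ.label g b := fun g b =>
    (continuous_apply b).comp ((continuous_apply g).comp continuous_induced_dom)
  have hopen : IsOpen (⋂ g ∈ Φ, ⋂ b, {σ : Tiled B W F | σ.label g b = β.label g b}) :=
    hΦ.isOpen_biInter fun g _ => isOpen_iInter_of_finite fun b =>
      (isOpen_discrete {β.label g b}).preimage (hcont g b)
  obtain ⟨_, hmem, k, rfl⟩ := mem_closure_iff.1 h _ hopen (by simp)
  refine ⟨k⁻¹, fun g hg => funext fun b => ?_⟩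
  simp only [mem_iInter, mem_ofPred_eq] at hmem
  exact (hmem g hg b).symm

theorem Tiled.IsLimitOf.isTiling [Finite B] {β τ : Tiled B W F} (h : β.IsLimitOf τ)
    (hτ : τ.IsTiling cs) : β.IsTiling cs := by
  intro g b
  obtain ⟨k, hk⟩ := h.exists_translate (toFinite {g, g * cs.simple b})
  rw [hk g (by simp), hk (g * cs.simple b) (by simp), ← mul_assoc]
  exact hτ _ b

theorem Tiled.IsLimitOf.strictlyBalanced [Fintype B] [Finite F] {β τ : Tiled B W F}
    (h : β.IsLimitOf τ) {κ : W → B → F} {s : F → W → ℤˣ}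
    (hτ : ∀ g b, τ.label g b = (κ g b, s (κ g b) g))
    (hκ : ∀ g b, κ (g * cs.simple b) b = κ g b)
    (hs : ∀ g b, s (κ g b) (g * cs.simple b) = -s (κ g b) g)
    (hs' : ∀ g b c, κ g b ≠ c → s c (g * cs.simple b) = s c g) : β.StrictlyBalanced := by
  rintro w hw ⟨_, ⟨g, rfl⟩, b, hb⟩
  have key : ∀ v : SignedColor F → ℤ, (∀ f, v (opp f) = -v f) → v (β.label g b) ≠ 0 →
      ∃ t ∈ β.tiles, 0 < ∑ b, v (t b) := by
    intro v hv hvb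
    -- The search takes at most one step per color, so it sees only this finite patch around g.
    have hfin : {l : List B | l.length ≤ Nat.card F}.Finite := List.finite_length_le B _
    obtain ⟨k, hk⟩ := h.exists_translate (hfin.image fun l => g * cs.wordProd l)
    have hg := hk g ⟨[], by simp, by simp⟩
    rw [hg, hτ] at hvb
    obtain ⟨l, hl, hpos⟩ := exists_pos_tile hκ hs hs' hv (k * g) ⟨b, hvb⟩
    refine ⟨_, ⟨g * cs.wordProd l, rfl⟩, ?_⟩
    rw [hk _ ⟨l, hl.trans (ncard_le_card _), rfl⟩, ← mul_assoc]
    simpa only [hτ] using hpos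
  refine ⟨key w hw hb, ?_⟩
  obtain ⟨t, ht, hpos⟩ := key (fun f => -w f) (fun f => by rw [hw]) (neg_ne_zero.2 hb)
  refine ⟨t, ht, ?_⟩
  rw [Finset.sum_neg_distrib] at hpos
  omega

theorem sign_mul_simple {φ : Wall cs → F} (ε : F → ℤˣ) (g : W) (b : B) :
    -ε (φ (wallAt cs g b)) * (-1) ^ depth φ (φ (wallAt cs g b)) (g * cs.simple b) =
      -(-ε (φ (wallAt cs g b)) * (-1) ^ depth φ (φ (wallAt cs g b)) g) := by
  rcases zmod_two_cases (sep (wallAt cs g b) g) with h | h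
  · rw [depth_mul_simple_of_eq rfl h, pow_succ]; simp
  · have h0 : sep (wallAt cs (g * cs.simple b) b) (g * cs.simple b) = 0 := by
      rw [wallAt_mul_simple, sep_mul_simple_self, h]; rfl
    have hd := depth_mul_simple_of_eq (φ := φ) rfl h0
    rw [cs.simple_mul_simple_cancel_right, wallAt_mul_simple] at hd
    rw [hd, pow_succ]; simp

end Balance

end DavisTiling

end

theorem theorem6 {B W F : Type*} [Fintype B] [Group W] {M : CoxeterMatrix B}
    (cs : CoxeterSystem M W) [Finite F] (φ : DavisTiling.Wall cs → F)
    (hφ : ∀ m n : DavisTiling.Wall cs, m ≠ n → φ m = φ n → Disjoint m.1 n.1)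
    (ε : F → ℤˣ) :
    (DavisTiling.resolution φ (DavisTiling.alternating φ ε)).IsTiling cs ∧
    (DavisTiling.resolution φ (DavisTiling.alternating φ ε)).StrictlyBalanced ∧
    ∀ β : DavisTiling.Tiled B W F,
      β.IsLimitOf (DavisTiling.resolution φ (DavisTiling.alternating φ ε)) →
      β.IsTiling cs ∧ β.StrictlyBalanced := by
  have hlabel := DavisTiling.resolution_label hφ ε
  have htiling : (DavisTiling.resolution φ (DavisTiling.alternating φ ε)).IsTiling cs := by
    intro g b
    rw [hlabel, hlabel, DavisTiling.wallAt_mul_simple, DavisTiling.sign_mul_simple]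
    rfl
  have hlimit : ∀ β : DavisTiling.Tiled B W F,
      β.IsLimitOf (DavisTiling.resolution φ (DavisTiling.alternating φ ε)) →
      β.IsTiling cs ∧ β.StrictlyBalanced := fun β hβ =>
    ⟨hβ.isTiling htiling, hβ.strictlyBalanced (cs := cs)
      (s := fun c g => -ε c * (-1) ^ DavisTiling.depth φ c g) hlabel
      (fun g b => by rw [DavisTiling.wallAt_mul_simple])
      (fun g b => DavisTiling.sign_mul_simple ε g b)
      (fun g b c hc => by rw [DavisTiling.depth_mul_simple_of_ne hc])⟩
  -- The resolution is a limit tiling of itself.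
  exact ⟨htiling, (hlimit _ (subset_closure (MulAction.mem_orbit_self _))).2, hlimit⟩
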